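/- For a finite group $G$ let $$B_0(G)=\bigcap_{A\le G,\ A\text{ abelian}}\ker\bigl(\operatorname{res}^G_A: H^2(G,\mathbb{Q}/\mathbb{Z})\to H^2(A,\mathbb{Q}/\mathbb{Z})\bigr)$$ be its Bogomolov multiplier, where the groups act trivially on $\mathbb{Q}/\mathbb{Z}$. For a prime $p>3$ let $$\Phi_9(1^5)=\langle \alpha,\alpha_1,\alpha_2,\alpha_3,\alpha_4 \mid [\alpha_i,\alpha]=\alpha_{i+1}\ (i=1,2,3),\ [\alpha_4,\alpha]=[\alpha_i,\alpha_j]=1\ (1\le i,j\le 4),\ \alpha^p=\alpha_i^p=1\ (1\le i\le 4)\rangle,$$ where $[x,y]=x^{-1}y^{-1}xy$, and let the family $\Phi_9$ consist of the groups isoclinic to $\Phi_9(1^5)$, that is, the groups $G$ for which there are isomorphisms $\theta:G/Z(G)\to H/Z(H)$ and $\psi:[G,G]\to[H,H]$, with $H=\Phi_9(1^5)$, such that $\psi([g_1,g_2])=[h_1,h_2]$ whenever $\theta(g_iZ(G))=h_iZ(H)$ for $i=1,2$. **Proposition 3.8.** Let $p>3$ be a prime and let $G$ be a group of order $p^5$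 that belongs to the family $\Phi_9$. Then $B_0(G)=0$. -/

import Mathlib

universe u

open CategoryTheory

noncomputable section

/-- The group `ℚ/ℤ` with the trivial action of `G`. Mathlib's group cohomology wants the group, the
base ring and the coefficients in one universe, whence the two `ULift`s. -/
abbrev trivialQModZ (G : Type u) [Group G] : Rep.{u} (ULift.{u} ℤ) G :=
  Rep.trivial (ULift.{u} ℤ) G (ULift.{u} (AddCircle (1 : ℚ)))

/-- The group `H²(G, ℚ/ℤ)`, for the trivial action of `G` on `ℚ/ℤ`. -/
abbrev SchurMultiplier (G : Type u) [Group G] : ModuleCat.{u} (ULift.{u} ℤ) :=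
  groupCohomology (trivialQModZ G) 2

/-- The restriction map `res : H²(G, ℚ/ℤ) → H²(A, ℚ/ℤ)` to a subgroup `A` of `G`. -/
def schurRestriction {G : Type u} [Group G] (A : Subgroup G) :
    SchurMultiplier G →ₗ[ULift.{u} ℤ]
      groupCohomology (Rep.res A.subtype (trivialQModZ G)) 2 :=
  (groupCohomology.map A.subtype (𝟙 (Rep.res A.subtype (trivialQModZ G))) 2).hom

/-- The Bogomolov multiplier `B₀(G)`: the classes in `H²(G, ℚ/ℤ)` whose restriction to every
abelian subgroup of `G` vanishes. -/
def bogomolovMultiplier (G : Type u) [Group G] :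
    Submodule (ULift.{u} ℤ) (SchurMultiplier G) :=
  ⨅ (A : Subgroup G) (_ : IsMulCommutative A), LinearMap.ker (schurRestriction A)

end

/-- The commutator `[x, y] = x⁻¹ y⁻¹ x y`. -/
def rightCommutator {G : Type*} [Group G] (x y : G) : G := x⁻¹ * y⁻¹ * x * y

/-- Isoclinism of groups (P. Hall): an isomorphism of the central quotients and an isomorphism of
the derived subgroups that are compatible with the commutator maps
`G/Z(G) × G/Z(G) → [G, G]` and `H/Z(H) × H/Z(H) → [H, H]`. -/
def Isoclinic (G H : Type*) [Group G] [Group H] : Prop :=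
  ∃ (θ : (G ⧸ Subgroup.center G) ≃* (H ⧸ Subgroup.center H))
    (ψ : commutator G ≃* commutator H),
    ∀ (g₁ g₂ : G) (h₁ h₂ : H),
      θ (g₁ : G ⧸ Subgroup.center G) = (h₁ : H ⧸ Subgroup.center H) →
      θ (g₂ : G ⧸ Subgroup.center G) = (h₂ : H ⧸ Subgroup.center H) →
      ∀ c : commutator G, (c : G) = rightCommutator g₁ g₂ →
        (ψ c : H) = rightCommutator h₁ h₂

/-- The generators `α, α₁, α₂, α₃, α₄` of `Φ₉(1⁵)`, as elements of the free group on five letters: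
`phi9Gen 0` is `α`, and `phi9Gen i` is `αᵢ` for `i = 1, 2, 3, 4`. -/
def phi9Gen (i : Fin 5) : FreeGroup (Fin 5) := FreeGroup.of i

/-- The relators of `Φ₉(1⁵)`: `[α₁, α] = α₂`, `[α₂, α] = α₃`, `[α₃, α] = α₄`, all other commutators
of two generators are trivial, and all generators have `p`-th power `1`. -/
def phi9Relators (p : ℕ) : Set (FreeGroup (Fin 5)) :=
  {rightCommutator (phi9Gen 1) (phi9Gen 0) * (phi9Gen 2)⁻¹,
    rightCommutator (phi9Gen 2) (phi9Gen 0) * (phi9Gen 3)⁻¹,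
    rightCommutator (phi9Gen 3) (phi9Gen 0) * (phi9Gen 4)⁻¹,
    rightCommutator (phi9Gen 4) (phi9Gen 0)} ∪
  {w | ∃ i j : Fin 5, i ≠ 0 ∧ j ≠ 0 ∧ w = rightCommutator (phi9Gen i) (phi9Gen j)} ∪
  {w | ∃ i : Fin 5, w = phi9Gen i ^ p}

/-- The group `Φ₉(1⁵)` of order `p⁵` (for a prime `p > 3`). -/
abbrev Phi9Stem (p : ℕ) : Type := PresentedGroup (phi9Relators p)

/-- `G` belongs to the family `Φ₉` for the prime `p > 3`, that is, to the isoclinism class of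
`Φ₉(1⁵)`. -/
def InFamilyPhi9 (p : ℕ) (G : Type*) [Group G] : Prop := Isoclinic G (Phi9Stem p)

/-! A class in `B₀(G)` is a central extension `E` of `G` by `M = ℚ/ℤ` in which lifts of commuting
elements commute. It splits as soon as `M ∩ [E, E]` is trivial: then `M` embeds in the
abelianization of `E`, and divisibility gives a retraction onto `M`. In `Φ₉(1⁵)` the `αᵢ` generate
an abelian normal subgroup with cyclic quotient. Such a subgroup can be transported along an
isoclinism to `G`, and its preimage in `E` is again abelian with cyclic quotient. Hence every
element of `[E, E]` is a single commutator `⁅b, t⁆`. If it lies in `M`, the images of `b` and `t`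
commute in `G`, so `b` and `t` commute in `E` and the element is trivial. -/

open scoped commutatorElement

/-! ### Commutators in abelian-by-cyclic groups -/

section AbelianByCyclic

variable {E : Type*} [Group E]

/-- `B` is an abelian normal subgroup whose quotient is generated by the class of `t`. -/
structure IsAbelianByCyclic (B : Subgroup E) (t : E) : Prop where
  normal : B.Normal
  comm : ∀ x ∈ B, ∀ y ∈ B, x * y = y * x
  exists_zpow : ∀ x, ∃ k : ℤ, x * t ^ k ∈ B

/-- In an abelian-by-cyclic group, every element of the derived subgroup is a single commutator
`⁅b, t⁆` with `b` in the abelian normal subgroup. -/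
theorem IsAbelianByCyclic.exists_eq_commutatorElement {B : Subgroup E} {t : E}
    (h : IsAbelianByCyclic B t) {c : E} (hc : c ∈ commutator E) : ∃ b ∈ B, c = ⁅b, t⁆ := by
  have hconj : ∀ b ∈ B, ∀ g, g * b * g⁻¹ ∈ B := fun b hb g => h.normal.conj_mem b hb g
  have hmem : ∀ b ∈ B, ⁅b, t⁆ ∈ B := fun b hb => by
    rw [commutatorElement_def, mul_assoc, mul_assoc, ← mul_assoc t]
    exact B.mul_mem hb (hconj _ (B.inv_mem hb) t)
  -- These commutators form a normal subgroup `D`. Modulo `D`, `t` commutes with the abelian image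
  -- of `B`, so `E ⧸ D` is abelian.
  let D : Subgroup E :=
    { carrier := {c | ∃ b ∈ B, c = ⁅b, t⁆}
      one_mem' := ⟨1, B.one_mem, by simp⟩
      mul_mem' := by
        rintro _ _ ⟨b, hb, rfl⟩ ⟨c, hc, rfl⟩
        refine ⟨b * c, B.mul_mem hb hc, ?_⟩
        have h1 := h.comm _ (hmem c hc) _ (hconj _ (B.inv_mem hb) t)
        have h2 := h.comm _ (hmem c hc) _ (hmem b hb)
        calc ⁅b, t⁆ * ⁅c, t⁆ = b * ((t * b⁻¹ * t⁻¹) * ⁅c, t⁆) := by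
              simp only [commutatorElement_def]; group
          _ = b * (⁅c, t⁆ * (t * b⁻¹ * t⁻¹)) := by rw [h1]
          _ = ⁅b * c, t⁆ := by simp only [commutatorElement_def]; group
      inv_mem' := by
        rintro _ ⟨b, hb, rfl⟩
        refine ⟨b⁻¹, B.inv_mem hb, ?_⟩
        have h1 := h.comm _ (B.inv_mem hb) _ (hconj _ hb t)
        calc ⁅b, t⁆⁻¹ = (t * b * t⁻¹) * b⁻¹ := by simp only [commutatorElement_def]; group
          _ = b⁻¹ * (t * b * t⁻¹) := h1.symm
          _ = ⁅b⁻¹, t⁆ := by simp only [commutatorElement_def]; group }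
  have hD : D.Normal := by
    refine ⟨?_⟩
    rintro _ ⟨b, hb, rfl⟩ g
    obtain ⟨k, hk⟩ := h.exists_zpow g
    refine ⟨t ^ (-k) * b * (t ^ (-k))⁻¹, hconj b hb _, ?_⟩
    -- Since `g * t ^ k` lies in the abelian group `B`, conjugation by `g` acts on `B` as
    -- conjugation by `t ^ (-k)`.
    have h1 := h.comm _ hk _ (hconj _ (hmem b hb) (t ^ (-k)))
    calc g * ⁅b, t⁆ * g⁻¹
        = (g * t ^ k) * (t ^ (-k) * ⁅b, t⁆ * (t ^ (-k))⁻¹) * (g * t ^ k)⁻¹ := by group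
      _ = t ^ (-k) * ⁅b, t⁆ * (t ^ (-k))⁻¹ := by rw [h1, mul_inv_cancel_right]
      _ = ⁅t ^ (-k) * b * (t ^ (-k))⁻¹, t⁆ := by
        simp only [commutatorElement_def]; group
  have hle : commutator E ≤ D := by
    rw [commutator_def, Subgroup.commutator_le]
    intro x _ y _
    let q : E →* E ⧸ D := QuotientGroup.mk' D
    have hqt : ∀ b ∈ B, Commute (q b) (q t) := fun b hb => by
      rw [← commutatorElement_eq_one_iff_commute, ← map_commutatorElement]
      exact (QuotientGroup.eq_one_iff _).2 ⟨b, hb, rfl⟩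
    have hdecomp : ∀ x, ∃ b ∈ B, ∃ k : ℤ, q x = q b * q t ^ k := fun x => by
      obtain ⟨k, hk⟩ := h.exists_zpow x
      exact ⟨_, hk, -k, by rw [← map_zpow, ← map_mul]; group⟩
    obtain ⟨b, hb, k, hx⟩ := hdecomp x
    obtain ⟨c, hc, l, hy⟩ := hdecomp y
    have hbc : Commute (q b) (q c) := (show Commute b c from h.comm b hb c hc).map q
    have : Commute (q x) (q y) := by
      rw [hx, hy]
      exact (hbc.mul_right ((hqt b hb).zpow_right l)).mul_left
        (((hqt c hc).symm.zpow_left k).mul_right ((Commute.refl (q t)).zpow_zpow k l))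
    rw [← commutatorElement_eq_one_iff_commute, ← map_commutatorElement] at this
    exact (QuotientGroup.eq_one_iff _).1 this
  exact hle hc

end AbelianByCyclic

/-! ### The central extension of a 2-cocycle -/

section CocycleExtension

variable {G M : Type*} [Group G] [AddCommGroup M]

/-- The central extension of `G` by `M` with factor set the 2-cocycle `f`. -/
@[ext]
structure CocycleExtension (f : G → G → M)
    (hf : ∀ g h j, f (g * h) j + f g h = f h j + f g (h * j)) where
  /-- The image in `G`. -/
  base : G
  /-- The coordinate in `M`. -/
  fiber : M

namespace CocycleExtension

variable {f : G → G → M} {hf : ∀ g h j, f (g * h) j + f g h = f h j + f g (h * j)}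

instance : Mul (CocycleExtension f hf) :=
  ⟨fun x y => ⟨x.base * y.base, x.fiber + y.fiber + f x.base y.base⟩⟩

/-- The cocycle is not assumed normalized, hence the correction by `f 1 1`. -/
instance : One (CocycleExtension f hf) := ⟨⟨1, -f 1 1⟩⟩

instance : Inv (CocycleExtension f hf) :=
  ⟨fun x => ⟨x.base⁻¹, -x.fiber - f x.base⁻¹ x.base - f 1 1⟩⟩

@[simp] theorem base_mul (x y : CocycleExtension f hf) : (x * y).base = x.base * y.base := rfl

@[simp] theorem fiber_mul (x y : CocycleExtension f hf) :
    (x * y).fiber = x.fiber + y.fiber + f x.base y.base := rfl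

@[simp] theorem base_one : (1 : CocycleExtension f hf).base = 1 := rfl

@[simp] theorem fiber_one : (1 : CocycleExtension f hf).fiber = -f 1 1 := rfl

@[simp] theorem base_inv (x : CocycleExtension f hf) : (x⁻¹).base = x.base⁻¹ := rfl

@[simp] theorem fiber_inv (x : CocycleExtension f hf) :
    (x⁻¹).fiber = -x.fiber - f x.base⁻¹ x.base - f 1 1 := rfl

theorem cocycle_one_left
    (hf : ∀ g h j, f (g * h) j + f g h = f h j + f g (h * j)) (g : G) : f 1 g = f 1 1 := by
  simpa using (hf 1 1 g).symm

instance : Group (CocycleExtension f hf) :=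
  Group.ofLeftAxioms
    (fun x y z => by
      ext
      · exact mul_assoc _ _ _
      · have := hf x.base y.base z.base
        simp only [fiber_mul, base_mul]
        rw [show ∀ a b c d e : M, a + b + c + d + e = a + b + d + (e + c) by intros; abel, this]
        abel)
    (fun x => by
      ext
      · exact one_mul _
      · simp [cocycle_one_left hf x.base])
    (fun x => by
      ext
      · exact inv_mul_cancel _
      · simp only [fiber_mul, fiber_inv, base_inv, fiber_one]
        abel)

/-- The projection onto `G`. -/
@[simps]
def proj : CocycleExtension f hf →* G where
  toFun := base
  map_one' := rfl
  map_mul' _ _ := rfl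

/-- The embedding of `M` as a central subgroup. -/
def incl (m : M) : CocycleExtension f hf := ⟨1, m - f 1 1⟩

theorem incl_add (m n : M) : (incl (m + n) : CocycleExtension f hf) = incl m * incl n := by
  ext
  · simp [incl]
  · simp only [incl, fiber_mul]
    abel

theorem incl_mul (m : M) (g : G) :
    incl m * (⟨g, 0⟩ : CocycleExtension f hf) = ⟨g, m⟩ := by
  ext
  · simp [incl]
  · simp [incl, cocycle_one_left hf g]

/-- If `M` meets the derived subgroup of the extension trivially and `M` is divisible, then the
extension splits, that is, its 2-cocycle is a coboundary. -/
theorem exists_cochain [DivisibleBy M ℤ]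
    (hM : ∀ m, (incl m : CocycleExtension f hf) ∈ commutator (CocycleExtension f hf) → m = 0) :
    ∃ b : G → M, ∀ g h, f g h = b g + b h - b (g * h) := by
  let j : M →+ Additive (Abelianization (CocycleExtension f hf)) :=
    AddMonoidHom.mk' (fun m => Additive.ofMul (Abelianization.of (incl m))) fun m n => by
      rw [incl_add, map_mul, ofMul_mul]
  have hj : Function.Injective j := by
    rw [injective_iff_map_eq_zero]
    intro m hm
    apply hM
    rw [← Abelianization.ker_of, MonoidHom.mem_ker]
    exact hm
  -- Divisible groups are injective, so the identity of `M` extends along `j`; evaluating `χ` on the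
  -- section `g ↦ ⟨g, 0⟩` gives the cochain.
  obtain ⟨χ, hχ⟩ := (Module.Baer.of_divisible M).extension_property_addMonoidHom j hj
    (AddMonoidHom.id M)
  have hχ' : ∀ m, χ (Additive.ofMul (Abelianization.of (incl m))) = m :=
    fun m => DFunLike.congr_fun hχ m
  let b : G → M := fun g => χ (Additive.ofMul (Abelianization.of ⟨g, 0⟩))
  have hb : ∀ g m, χ (Additive.ofMul (Abelianization.of ⟨g, m⟩)) = m + b g := fun g m => by
    rw [← incl_mul, map_mul, ofMul_mul, map_add, hχ']
  refine ⟨b, fun g h => ?_⟩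
  have : (⟨g, 0⟩ * ⟨h, 0⟩ : CocycleExtension f hf) = ⟨g * h, f g h⟩ := by
    ext
    · rfl
    · simp
  rw [eq_sub_iff_add_eq, ← hb, ← this, map_mul, ofMul_mul, map_add]

/-- Over a group with an abelian normal subgroup and cyclic quotient, a 2-cocycle with values in a
divisible group that is symmetric on commuting pairs is a coboundary. -/
theorem exists_cochain_of_isAbelianByCyclic [DivisibleBy M ℤ] {A : Subgroup G} {t : G}
    (hA : IsAbelianByCyclic A t) (hf : ∀ g h j, f (g * h) j + f g h = f h j + f g (h * j))
    (hsymm : ∀ x y, x * y = y * x → f x y = f y x) :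
    ∃ b : G → M, ∀ g h, f g h = b g + b h - b (g * h) := by
  have hcomm : ∀ x y : CocycleExtension f hf, x.base * y.base = y.base * x.base →
      x * y = y * x := fun x y h => by
    ext
    · exact h
    · simp only [fiber_mul, hsymm _ _ h, add_comm x.fiber]
  have hB : IsAbelianByCyclic (A.comap (proj : CocycleExtension f hf →* G)) ⟨t, 0⟩ :=
    { normal := hA.normal.comap _
      comm := fun x hx y hy => hcomm x y (hA.comm _ hx _ hy)
      exists_zpow := fun x => by
        obtain ⟨k, hk⟩ := hA.exists_zpow x.base
        refine ⟨k, ?_⟩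
        rwa [Subgroup.mem_comap, map_mul, map_zpow] }
  refine exists_cochain (hf := hf) fun m hm => ?_
  obtain ⟨b, -, hb⟩ := hB.exists_eq_commutatorElement hm
  have h1 : ⁅b.base, t⁆ = 1 := by
    have := congrArg proj hb
    rw [map_commutatorElement] at this
    exact this.symm
  have h2 : ⁅b, (⟨t, 0⟩ : CocycleExtension f hf)⁆ = 1 :=
    commutatorElement_eq_one_iff_mul_comm.2
      (hcomm _ _ (commutatorElement_eq_one_iff_mul_comm.1 h1))
  have h3 := congrArg fiber (hb.trans h2)
  simpa [incl] using h3

end CocycleExtension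

end CocycleExtension

/-! ### The Bogomolov multiplier of an abelian-by-cyclic group -/

section Bogomolov

open groupCohomology

universe v

/-- A 2-cocycle whose class lies in the Bogomolov multiplier is symmetric on commuting pairs. -/
theorem cocycle_symm_of_mem_bogomolovMultiplier {G : Type v} [Group G]
    (f : cocycles₂ (trivialQModZ G)) (hf : H2π (trivialQModZ G) f ∈ bogomolovMultiplier G)
    (x y : G) (hxy : x * y = y * x) : f (x, y) = f (y, x) := by
  -- The restriction of `f` to this abelian subgroup is a coboundary, and coboundaries are symmetric
  -- on commuting pairs.
  let A : Subgroup G := Subgroup.closure {x, y}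
  have hA : IsMulCommutative A := by
    refine Subgroup.isMulCommutative_closure ?_
    rintro _ (rfl | rfl) _ (rfl | rfl) <;> simp [hxy]
  have h1 : schurRestriction A (H2π (trivialQModZ G) f) = 0 := by
    simp only [bogomolovMultiplier, Submodule.mem_iInf, LinearMap.mem_ker] at hf
    exact hf A hA
  have h2 : schurRestriction A (H2π (trivialQModZ G) f) =
      H2π _ (mapCocycles₂ A.subtype (𝟙 (Rep.res A.subtype (trivialQModZ G))) f) :=
    H2π_comp_map_apply A.subtype (𝟙 (Rep.res A.subtype (trivialQModZ G))) f
  rw [h2, H2π_eq_zero_iff] at h1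
  obtain ⟨b, hb⟩ := h1
  let x' : A := ⟨x, Subgroup.subset_closure (by simp)⟩
  let y' : A := ⟨y, Subgroup.subset_closure (by simp)⟩
  have hx : b y' - b (x' * y') + b x' = f (x, y) := congrFun hb (x', y')
  have hy : b x' - b (y' * x') + b y' = f (y, x) := congrFun hb (y', x')
  have hxy' : x' * y' = y' * x' := Subtype.ext hxy
  rw [← hx, ← hy, hxy']
  abel

/-- Bogomolov: `B₀(G) = 0` if `G` has an abelian normal subgroup with cyclic quotient. -/
theorem bogomolovMultiplier_eq_bot_of_isAbelianByCyclic {G : Type v} [Group G]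
    {A : Subgroup G} {t : G} (hA : IsAbelianByCyclic A t) : bogomolovMultiplier G = ⊥ := by
  rw [eq_bot_iff]
  intro c hc
  rw [Submodule.mem_bot]
  induction c using H2_induction_on with | h f => ?_
  have hcoc := (mem_cocycles₂_iff (A := trivialQModZ G) f).1 f.2
  have hsymm := cocycle_symm_of_mem_bogomolovMultiplier f hc
  let F : G → G → AddCircle (1 : ℚ) := fun g h => (f (g, h) : ULift _).down
  obtain ⟨b, hb⟩ := CocycleExtension.exists_cochain_of_isAbelianByCyclic (f := F) hA
    (fun g h j => congrArg ULift.down (hcoc g h j))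
    (fun x y hxy => congrArg ULift.down (hsymm x y hxy))
  rw [H2π_eq_zero_iff]
  refine ⟨fun g => ULift.up (b g), funext fun ⟨g, h⟩ => ULift.down_injective ?_⟩
  have : b h - b (g * h) + b g = F g h := by
    rw [hb]
    abel
  exact this

end Bogomolov

/-! ### The family `Φ₉` -/

section Isoclinism

variable {G H : Type*} [Group G] [Group H]

theorem rightCommutator_eq_one_iff {x y : G} : rightCommutator x y = 1 ↔ x * y = y * x := by
  rw [rightCommutator, mul_assoc, ← mul_inv_rev, inv_mul_eq_one, eq_comm]

theorem rightCommutator_mem_commutator (x y : G) : rightCommutator x y ∈ commutator G := by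
  have h : rightCommutator x y = ⁅x⁻¹, y⁻¹⁆ := by simp [rightCommutator, commutatorElement_def]
  rw [h, commutator_def]
  exact Subgroup.commutator_mem_commutator (Subgroup.mem_top _) (Subgroup.mem_top _)

/-- Having an abelian normal subgroup with cyclic quotient is invariant under isoclinism. -/
theorem Isoclinic.exists_isAbelianByCyclic (h : Isoclinic G H) {A : Subgroup H} {t : H}
    (hA : IsAbelianByCyclic A t) : ∃ (B : Subgroup G) (u : G), IsAbelianByCyclic B u := by
  obtain ⟨θ, ψ, hψ⟩ := h
  let q : G →* H ⧸ Subgroup.center H := θ.toMonoidHom.comp (QuotientGroup.mk' _)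
  have hq : Function.Surjective q := θ.surjective.comp (QuotientGroup.mk'_surjective _)
  obtain ⟨u, hu⟩ := hq (QuotientGroup.mk' _ t)
  refine ⟨(A.map (QuotientGroup.mk' (Subgroup.center H))).comap q, u, ?_, ?_, ?_⟩
  · exact (hA.normal.map _ (QuotientGroup.mk'_surjective _)).comap _
  · rintro x ⟨a, ha, hax⟩ y ⟨b, hb, hby⟩
    -- `ψ` sends the commutator of `x` and `y` to that of `a` and `b`, which is trivial; injectivity
    -- of `ψ` concludes.
    have h1 := hψ x y a b hax.symm hby.symm
      ⟨_, rightCommutator_mem_commutator x y⟩ rfl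
    rw [rightCommutator_eq_one_iff.2 (hA.comm a ha b hb), OneMemClass.coe_eq_one,
      map_eq_one_iff ψ ψ.injective] at h1
    exact rightCommutator_eq_one_iff.1 (congrArg Subtype.val h1)
  · intro x
    obtain ⟨a, ha⟩ := QuotientGroup.mk'_surjective _ (q x)
    obtain ⟨k, hk⟩ := hA.exists_zpow a
    exact ⟨k, a * t ^ k, hk, by rw [map_mul, map_mul, map_zpow, map_zpow, ha, hu]⟩

end Isoclinism

/-- The subgroup `⟨α₁, α₂, α₃, α₄⟩` of `Φ₉(1⁵)` is abelian and normal, with quotient generated by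
the class of `α`. -/
theorem isAbelianByCyclic_phi9Stem (p : ℕ) :
    IsAbelianByCyclic
      (Subgroup.closure {x : Phi9Stem p | ∃ i : Fin 5, i ≠ 0 ∧ x = PresentedGroup.of i})
      (PresentedGroup.of 0) := by
  set S : Set (Phi9Stem p) := {x | ∃ i : Fin 5, i ≠ 0 ∧ x = PresentedGroup.of i} with hS
  set A := Subgroup.closure S
  let a : Fin 5 → Phi9Stem p := PresentedGroup.of
  have hmap : ∀ w ∈ phi9Relators p, PresentedGroup.mk (phi9Relators p) w = 1 :=
    fun w hw => PresentedGroup.one_of_mem hw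
  have ha : ∀ i, i ≠ 0 → a i ∈ A := fun i hi => Subgroup.subset_closure ⟨i, hi, rfl⟩
  have hcomm : ∀ i j : Fin 5, i ≠ 0 → j ≠ 0 → a i * a j = a j * a i := fun i j hi hj =>
    rightCommutator_eq_one_iff.1 (hmap _ (Or.inl (Or.inr ⟨i, j, hi, hj, rfl⟩)))
  have hrel : ∀ {x y z : Phi9Stem p}, rightCommutator x y * z⁻¹ = 1 → y⁻¹ * x * y = x * z := by
    intro x y z h
    rw [← mul_inv_eq_one.1 h, rightCommutator]
    group
  have h1 : (a 0)⁻¹ * a 1 * a 0 = a 1 * a 2 := hrel (hmap _ (Or.inl (Or.inl (Or.inl rfl))))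
  have h2 : (a 0)⁻¹ * a 2 * a 0 = a 2 * a 3 :=
    hrel (hmap _ (Or.inl (Or.inl (Or.inr (Or.inl rfl)))))
  have h3 : (a 0)⁻¹ * a 3 * a 0 = a 3 * a 4 :=
    hrel (hmap _ (Or.inl (Or.inl (Or.inr (Or.inr (Or.inl rfl))))))
  have h4 : (a 0)⁻¹ * a 4 * a 0 = a 4 := by
    have h : a 4 * a 0 = a 0 * a 4 :=
      rightCommutator_eq_one_iff.1 (hmap _ (Or.inl (Or.inl (Or.inr (Or.inr (Or.inr rfl))))))
    rw [mul_assoc, h, inv_mul_cancel_left]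
  -- The relations describe conjugation by `α⁻¹`, but normality also needs conjugation by `α`. It is
  -- recovered by descending from `α₄`, which commutes with `α`.
  have hback : ∀ {x z : Phi9Stem p}, (a 0)⁻¹ * x * a 0 = x * z → a 0 * z * (a 0)⁻¹ ∈ A → x ∈ A →
      a 0 * x * (a 0)⁻¹ ∈ A := by
    intro x z h hz hx
    have : a 0 * x * (a 0)⁻¹ = x * (a 0 * z * (a 0)⁻¹)⁻¹ := by
      rw [eq_mul_inv_iff_mul_eq]
      calc a 0 * x * (a 0)⁻¹ * (a 0 * z * (a 0)⁻¹) = a 0 * (x * z) * (a 0)⁻¹ := by group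
        _ = x := by rw [← h]; group
    rw [this]
    exact A.mul_mem hx (A.inv_mem hz)
  have g4 : a 0 * a 4 * (a 0)⁻¹ ∈ A :=
    hback (z := 1) (by rw [h4, mul_one]) (by simp) (ha 4 (by decide))
  have g3 := hback h3 g4 (ha 3 (by decide))
  have g2 := hback h2 g3 (ha 2 (by decide))
  have g1 := hback h1 g2 (ha 1 (by decide))
  have hstable : ∀ g : Phi9Stem p, (∀ s ∈ S, g * s * g⁻¹ ∈ A) → ∀ x ∈ A, g * x * g⁻¹ ∈ A := by
    intro g hg x hx
    have : A ≤ A.comap (MulAut.conj g).toMonoidHom := (Subgroup.closure_le _).2 hg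
    exact this hx
  have hpos : ∀ x ∈ A, a 0 * x * (a 0)⁻¹ ∈ A := by
    refine hstable _ ?_
    rintro _ ⟨i, hi, rfl⟩
    fin_cases i
    exacts [absurd rfl hi, g1, g2, g3, g4]
  have hneg : ∀ x ∈ A, (a 0)⁻¹ * x * a 0 ∈ A := by
    have := hstable (a 0)⁻¹ ?_
    · simpa using this
    rintro _ ⟨i, hi, rfl⟩
    rw [inv_inv]
    fin_cases i
    · exact absurd rfl hi
    · exact h1 ▸ A.mul_mem (ha 1 (by decide)) (ha 2 (by decide))
    · exact h2 ▸ A.mul_mem (ha 2 (by decide)) (ha 3 (by decide))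
    · exact h3 ▸ A.mul_mem (ha 3 (by decide)) (ha 4 (by decide))
    · exact h4.symm ▸ ha 4 (by decide)
  have hnormal : A.Normal := by
    rw [← Subgroup.normalizer_eq_top_iff, eq_top_iff, ← PresentedGroup.closure_range_of,
      Subgroup.closure_le]
    rintro _ ⟨i, rfl⟩
    by_cases hi : i = 0
    · subst hi
      refine Subgroup.mem_normalizer_iff.2 fun x => ⟨hpos x, fun hx => ?_⟩
      have := hneg _ hx
      rwa [show (a 0)⁻¹ * (a 0 * x * (a 0)⁻¹) * a 0 = x by group] at this
    · exact Subgroup.le_normalizer (ha i hi)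
  refine ⟨hnormal, ?_, ?_⟩
  · have : IsMulCommutative A := by
      refine Subgroup.isMulCommutative_closure ?_
      rintro _ ⟨i, hi, rfl⟩ _ ⟨j, hj, rfl⟩
      exact hcomm i j hi hj
    exact fun x hx y hy => setLike_mul_comm hx hy
  · have htop : A ⊔ Subgroup.zpowers (a 0) = ⊤ := by
      rw [eq_top_iff, ← PresentedGroup.closure_range_of, Subgroup.closure_le]
      rintro _ ⟨i, rfl⟩
      by_cases hi : i = 0
      · subst hi
        exact Subgroup.mem_sup_right (Subgroup.mem_zpowers _)
      · exact Subgroup.mem_sup_left (ha i hi)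
    intro x
    obtain ⟨y, hy, z, ⟨k, rfl⟩, rfl⟩ :=
      Subgroup.mem_sup_of_normal_left.1 (htop ▸ Subgroup.mem_top x)
    exact ⟨-k, by simpa [a] using hy⟩

theorem proposition3p8 (p : ℕ) (hp : p.Prime) (hp3 : 3 < p) (G : Type*) [Group G]
    (hG : Nat.card G = p ^ 5) (hPhi : InFamilyPhi9 p G) :
    bogomolovMultiplier G = ⊥ := by
  obtain ⟨A, t, hA⟩ := Isoclinic.exists_isAbelianByCyclic hPhi (isAbelianByCyclic_phi9Stem p)
  exact bogomolovMultiplier_eq_bot_of_isAbelianByCyclic hA
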